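/- Let $V$ be a finite-dimensional real vector space, let $G\subseteq \mathrm{GL}(V)$ be a finite group, and let $\langle\cdot,\cdot\rangle$ be an inner product on $V$ that is preserved by $G$. For $v\in V$ let $O_v=\{gv: g\in G\}$ be its orbit, $\widehat{O}_v$ the convex hull of $O_v$, $G_v=\{g\in G: gv=v\}$ its stabilizer, and $$C_v=\{u\in V:\ \langle u, v-gv\rangle\ge 0\ \text{ for all } g\in G\}.$$ Call $v$ regular if $G_v$ is minimal among stabilizers, i.e. for $u\in V$, $G_u\subseteq G_v$ implies $G_u=G_v$. We say that $G$ satisfies SP if the family $\{\widehat{O}_v\}_{v\in V}$ is a semigroup with respect to the Minkowski addition, i.e. for all $u,v\in V$ there is $w\in V$ with $\widehat{O}_u+\widehat{O}_v=\widehat{O}_w$. Theorem 2. SP is equivalent to each of the following properties: (i) for every regular $v\in V$, the linear functional $x\mapsto\langle v,x\rangle$ attains its maximum on each $G$-orbit in $V$ at exactly one point of the orbit; (ii) $G$ is a Coxeter group, i.e. it is generated by (orthogonal) reflections in hyperplanes; (iii) for every regular $v\in V$ there is a neighbourhood $U$ of $v$ in $V$ such that $C_u=C_v$ for all $u\in U$.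 -/

import Mathlib

open scoped Pointwise Topology RealInnerProductSpace

namespace LinearGroup

variable {V : Type*} [NormedAddCommGroup V] [InnerProductSpace ℝ V]

/-- Property SP: the family of the convex hulls of the orbits of the linear group `G` is a semigroup
with respect to the Minkowski addition, i.e. it is closed under that addition. -/
def SP (G : Subgroup (V ≃ₗ[ℝ] V)) : Prop :=
  ∀ u v : V, ∃ w : V,
    convexHull ℝ (MulAction.orbit G u) + convexHull ℝ (MulAction.orbit G v) =
      convexHull ℝ (MulAction.orbit G w)

/-- A vector is regular if its stabilizer is minimal among all stabilizers of vectors. -/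
def IsRegular (G : Subgroup (V ≃ₗ[ℝ] V)) (v : V) : Prop :=
  ∀ u : V, MulAction.stabilizer G u ≤ MulAction.stabilizer G v →
    MulAction.stabilizer G u = MulAction.stabilizer G v

/-- The peak set of a real function on `X`: the set of its maximum points on `X`. -/
def peakSet (f : V → ℝ) (X : Set V) : Set V :=
  {x | x ∈ X ∧ ∀ y ∈ X, f y ≤ f x}

/-- A function has a peak on `X` if its peak set on `X` is a single point. -/
def HasPeak (f : V → ℝ) (X : Set V) : Prop :=
  ∃ x : V, peakSet f X = {x}

/-- `g` is the orthogonal reflection in a hyperplane, the orthogonal complement of some `a ≠ 0`. -/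
def IsHyperplaneReflection (g : V ≃ₗ[ℝ] V) : Prop :=
  ∃ a : V, a ≠ 0 ∧ ∀ x : V, g x = (ℝ ∙ a)ᗮ.reflection x

/-- A finite linear group that is generated by the reflections in hyperplanes which it contains. -/
def IsCoxeter (G : Subgroup (V ≃ₗ[ℝ] V)) : Prop :=
  Finite G ∧ Subgroup.closure {g : V ≃ₗ[ℝ] V | g ∈ G ∧ IsHyperplaneReflection g} = G

/-- The cone `C_v = {u : ⟪u, v - g v⟫ ≥ 0 for all g ∈ G}`. -/
def cone (G : Subgroup (V ≃ₗ[ℝ] V)) (v : V) : Set V :=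
  {u | ∀ g ∈ G, 0 ≤ ⟪u, v - g v⟫}

end LinearGroup

namespace LinearGroup

variable {V : Type*} [NormedAddCommGroup V] [InnerProductSpace ℝ V]

/-! Regular vectors are those with trivial stabilizer, since finitely many proper fixed spaces
cannot cover `V`. The maximum points of `⟪v, ·⟫` on an orbit are its points in `cone G v`, so (i)
says that this cone meets each orbit only once. All implications pass through this form of (i).

SP gives (i): if `x` and `g x` lie in the cone of a regular `v`, then `v + x` and `v + g x` are both
longest vectors of the sum of hulls, hence lie in one orbit (`SP.apply_eq_of_mem_cone`).

(i) gives (ii): a generic segment from `v` crosses between cones only at points fixed by products of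
reflections (`PreservesInner.closure_reflections_eq`).

(ii) gives SP and (iii): by an exchange argument a closed chamber meets each orbit at most once, so
it equals the cone. Linear functionals then attain their maxima on the orbits of all points of one
chamber at a common group element, which makes the hulls additive.

(iii) gives (i): equal maxima that persist for all `u` near `v` force `g x = x`. -/

/-- Every element of the linear group preserves the inner product. -/
def PreservesInner (G : Subgroup (V ≃ₗ[ℝ] V)) : Prop :=
  ∀ g ∈ G, ∀ x y : V, ⟪g x, g y⟫ = ⟪x, y⟫

variable {G : Subgroup (V ≃ₗ[ℝ] V)}

theorem mem_orbit_iff_exists {u x : V} :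
    x ∈ MulAction.orbit G u ↔ ∃ g ∈ G, g u = x :=
  ⟨fun ⟨g, hg⟩ => ⟨g, g.2, hg⟩, fun ⟨g, hg, h⟩ => ⟨⟨g, hg⟩, h⟩⟩

theorem apply_mem_orbit {g : V ≃ₗ[ℝ] V} (hg : g ∈ G) (u : V) : g u ∈ MulAction.orbit G u :=
  mem_orbit_iff_exists.2 ⟨g, hg, rfl⟩

theorem apply_inv_apply (g : V ≃ₗ[ℝ] V) (x : V) : g (g⁻¹ x) = x :=
  g.apply_symm_apply x

theorem inv_apply_apply (g : V ≃ₗ[ℝ] V) (x : V) : g⁻¹ (g x) = x :=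
  g.symm_apply_apply x

theorem PreservesInner.inner_inv_left (hG : PreservesInner G) {g : V ≃ₗ[ℝ] V} (hg : g ∈ G)
    (x y : V) : ⟪g⁻¹ x, y⟫ = ⟪x, g y⟫ := by
  rw [← hG g hg (g⁻¹ x) y, apply_inv_apply]

theorem PreservesInner.inner_inv_right (hG : PreservesInner G) {g : V ≃ₗ[ℝ] V} (hg : g ∈ G)
    (x y : V) : ⟪x, g⁻¹ y⟫ = ⟪g x, y⟫ := by
  rw [← hG g hg x (g⁻¹ y), apply_inv_apply]

theorem PreservesInner.norm_apply (hG : PreservesInner G) {g : V ≃ₗ[ℝ] V} (hg : g ∈ G) (x : V) :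
    ‖g x‖ = ‖x‖ := by
  rw [norm_eq_sqrt_real_inner, norm_eq_sqrt_real_inner x, hG g hg]

theorem eq_of_inner_le_inner_of_norm_eq {x y : V} (hn : ‖y‖ = ‖x‖) (h : ⟪x, x⟫ ≤ ⟪x, y⟫) :
    y = x := by
  have h1 : ‖y - x‖ ^ 2 = ‖y‖ ^ 2 - 2 * ⟪y, x⟫ + ‖x‖ ^ 2 := norm_sub_sq_real y x
  rw [hn, real_inner_comm] at h1
  rw [real_inner_self_eq_norm_sq] at h
  have h2 : ‖y - x‖ = 0 := by
    have : ‖y - x‖ ^ 2 ≤ 0 := by linarith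
    exact pow_eq_zero_iff two_ne_zero |>.1 (le_antisymm this (sq_nonneg _))
  exact sub_eq_zero.1 (norm_eq_zero.1 h2)

/-! ### The cones -/

theorem mem_cone_iff {u v : V} : u ∈ cone G v ↔ ∀ g ∈ G, ⟪u, g v⟫ ≤ ⟪u, v⟫ := by
  simp [cone, inner_sub_right]

theorem PreservesInner.mem_cone_iff_inner_left (hG : PreservesInner G) {u v : V} :
    u ∈ cone G v ↔ ∀ g ∈ G, ⟪v, g u⟫ ≤ ⟪v, u⟫ := by
  rw [mem_cone_iff]
  constructor <;> intro h g hg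
  · have := h g⁻¹ (inv_mem hg)
    rwa [hG.inner_inv_right hg, real_inner_comm, real_inner_comm v u] at this
  · have := h g⁻¹ (inv_mem hg)
    rwa [hG.inner_inv_right hg, real_inner_comm, real_inner_comm u v] at this

theorem PreservesInner.mem_cone_comm (hG : PreservesInner G) {u v : V} :
    u ∈ cone G v ↔ v ∈ cone G u := by
  rw [hG.mem_cone_iff_inner_left, mem_cone_iff]

theorem PreservesInner.mem_cone_apply (hG : PreservesInner G) {g : V ≃ₗ[ℝ] V} (hg : g ∈ G)
    {u v : V} : u ∈ cone G (g v) ↔ g⁻¹ u ∈ cone G v := by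
  rw [mem_cone_iff, mem_cone_iff]
  constructor <;> intro h k hk
  · rw [hG.inner_inv_left hg, hG.inner_inv_left hg]
    simpa [inv_apply_apply] using h (g * k * g⁻¹) (mul_mem (mul_mem hg hk) (inv_mem hg))
  · have := h (g⁻¹ * k * g) (mul_mem (mul_mem (inv_mem hg) hk) hg)
    rw [hG.inner_inv_left hg, hG.inner_inv_left hg] at this
    simpa [apply_inv_apply] using this

theorem isClosed_cone (v : V) : IsClosed (cone G v) := by
  have : cone G v = ⋂ g ∈ G, {u : V | 0 ≤ ⟪u, v - g v⟫} := by
    ext u; simp [cone]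
  rw [this]
  exact isClosed_biInter fun g _ => isClosed_le continuous_const (by fun_prop)

theorem PreservesInner.exists_apply_mem_cone [Finite G] (hG : PreservesInner G) (v u : V) :
    ∃ g ∈ G, g u ∈ cone G v := by
  obtain ⟨g, hg⟩ := Finite.exists_max fun g : G => ⟪v, (g : V ≃ₗ[ℝ] V) u⟫
  refine ⟨g, g.2, hG.mem_cone_iff_inner_left.2 fun k hk => ?_⟩
  simpa using hg (⟨k, hk⟩ * g)

theorem PreservesInner.mem_peakSet_iff (hG : PreservesInner G) {u v x : V} :
    x ∈ peakSet (fun y : V => ⟪v, y⟫) (MulAction.orbit G u) ↔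
      x ∈ MulAction.orbit G u ∧ x ∈ cone G v := by
  refine and_congr_right fun hx => ?_
  rw [hG.mem_cone_iff_inner_left]
  rw [← MulAction.orbit_eq_iff] at hx
  rw [← hx]
  refine ⟨fun h g hg => h _ (apply_mem_orbit hg x), fun h y hy => ?_⟩
  obtain ⟨g, hg, rfl⟩ := mem_orbit_iff_exists.1 hy
  exact h g hg

theorem PreservesInner.forall_hasPeak_iff [Finite G] (hG : PreservesInner G) {v : V} :
    (∀ u : V, HasPeak (fun x : V => ⟪v, x⟫) (MulAction.orbit G u)) ↔
      ∀ x ∈ cone G v, ∀ g ∈ G, g x ∈ cone G v → g x = x := by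
  constructor
  · intro h x hx g hg hgx
    obtain ⟨p, hp⟩ := h x
    have h1 : x ∈ ({p} : Set V) := hp ▸ hG.mem_peakSet_iff.2 ⟨MulAction.mem_orbit_self x, hx⟩
    have h2 : g x ∈ ({p} : Set V) := hp ▸ hG.mem_peakSet_iff.2 ⟨apply_mem_orbit hg x, hgx⟩
    rw [Set.mem_singleton_iff] at h1 h2
    rw [h2, ← h1]
  · intro h u
    obtain ⟨g, hg, hgu⟩ := hG.exists_apply_mem_cone v u
    refine ⟨g u, Set.ext fun y => ?_⟩
    rw [hG.mem_peakSet_iff, Set.mem_singleton_iff]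
    constructor
    · rintro ⟨hy, hyv⟩
      obtain ⟨k, hk, rfl⟩ := mem_orbit_iff_exists.1 hy
      have := h (g u) hgu (k * g⁻¹) (mul_mem hk (inv_mem hg)) (by simpa [inv_apply_apply] using hyv)
      simpa [inv_apply_apply] using this
    · rintro rfl
      exact ⟨apply_mem_orbit hg u, hgu⟩

/-! ### Regular vectors -/

/-- The subspace of the vectors fixed by a linear automorphism. -/
def fixedSpace (g : V ≃ₗ[ℝ] V) : Submodule ℝ V :=
  LinearMap.eqLocus (g : V →ₗ[ℝ] V) LinearMap.id

theorem mem_fixedSpace {g : V ≃ₗ[ℝ] V} {x : V} : x ∈ fixedSpace g ↔ g x = x :=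
  Iff.rfl

theorem dense_iInter_compl_submodule [FiniteDimensional ℝ V] {ι : Type*} [Finite ι]
    (F : ι → Submodule ℝ V) (hF : ∀ i, F i ≠ ⊤) : Dense (⋂ i, (F i : Set V)ᶜ) := by
  have : CompleteSpace V := FiniteDimensional.complete ℝ V
  refine dense_iInter_of_isOpen
    (fun i => ((F i).closed_of_finiteDimensional).isOpen_compl) fun i => ?_
  rw [← interior_eq_empty_iff_dense_compl]
  by_contra h
  exact hF i ((F i).eq_top_of_nonempty_interior' (Set.nonempty_iff_ne_empty.2 h))

theorem fixedSpace_ne_top {g : V ≃ₗ[ℝ] V} (hg : g ≠ 1) : fixedSpace g ≠ ⊤ := fun h =>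
  hg (LinearEquiv.ext fun _ => mem_fixedSpace.1 (h ▸ Submodule.mem_top))

theorem exists_forall_apply_eq_self_imp [FiniteDimensional ℝ V] [Finite G] :
    ∃ v : V, ∀ g ∈ G, g v = v → g = 1 := by
  obtain ⟨v, hv⟩ := (dense_iInter_compl_submodule
    (fun g : {g : G // g ≠ 1} => fixedSpace (g.1 : V ≃ₗ[ℝ] V))
    fun g => fixedSpace_ne_top fun h => g.2 (Subtype.ext h)).nonempty
  rw [Set.mem_iInter] at hv
  refine ⟨v, fun g hg h => ?_⟩
  by_contra hne
  exact hv ⟨⟨g, hg⟩, fun h' => hne (congrArg Subtype.val h')⟩ (mem_fixedSpace.2 h)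

/-- Some vector has trivial stabilizer, so a minimal stabilizer contained in no larger family of
choices must itself be compared with `⊥` and equal it. -/
theorem isRegular_iff [FiniteDimensional ℝ V] [Finite G] {v : V} :
    IsRegular G v ↔ ∀ g ∈ G, g v = v → g = 1 := by
  have key : ∀ w : V, MulAction.stabilizer G w = ⊥ ↔ ∀ g ∈ G, g w = w → g = 1 := by
    intro w
    rw [Subgroup.eq_bot_iff_forall]
    refine ⟨fun h g hg hw => congrArg Subtype.val (h ⟨g, hg⟩ hw), fun h g hg => ?_⟩
    exact Subtype.ext (h g g.2 hg)
  rw [← key]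
  constructor
  · intro h
    obtain ⟨w, hw⟩ := exists_forall_apply_eq_self_imp (G := G)
    rw [← key] at hw
    rw [← h w (hw ▸ bot_le), hw]
  · intro h u hu
    rw [h] at hu ⊢
    exact le_bot_iff.1 hu

/-! ### Unique maxima from the semigroup property -/

/-- Strict convexity of the ball: if `p ∉ S`, the open half-space `⟪p, x⟫ < ⟪p, p⟫` contains `S`,
hence its hull, but not `p`. -/
theorem mem_of_mem_convexHull_of_norm_le {S : Set V} {p : V} {r : ℝ} (hS : ∀ x ∈ S, ‖x‖ = r)
    (hp : p ∈ convexHull ℝ S) (hr : r ≤ ‖p‖) : p ∈ S := by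
  by_contra hpS
  have hpr : ‖p‖ ≤ r := by
    have : convexHull ℝ S ⊆ Metric.closedBall 0 r :=
      convexHull_min (fun x hx => by simp [hS x hx]) (convex_closedBall 0 r)
    simpa using this hp
  have hpr' : ‖p‖ = r := le_antisymm hpr hr
  have hsub : convexHull ℝ S ⊆ {x | ⟪p, x⟫ < ⟪p, p⟫} := by
    refine convexHull_min (fun x hx => ?_) (convex_halfSpace_lt (f := fun x => ⟪p, x⟫) ?_ _)
    · by_contra h
      have := eq_of_inner_le_inner_of_norm_eq ((hS x hx).trans hpr'.symm) (not_lt.1 h)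
      exact hpS (this ▸ hx)
    · exact (innerₗ V p).isLinear
  exact lt_irrefl ⟪p, p⟫ (hsub hp)

theorem inner_le_of_mem_convexHull {S : Set V} {x p : V} {c : ℝ} (hS : ∀ y ∈ S, ⟪x, y⟫ ≤ c)
    (hp : p ∈ convexHull ℝ S) : ⟪x, p⟫ ≤ c :=
  convexHull_min (t := {y | ⟪x, y⟫ ≤ c}) hS
    (convex_halfSpace_le (f := fun y => ⟪x, y⟫) (innerₗ V x).isLinear c) hp

theorem SP.apply_eq_of_mem_cone (hG : PreservesInner G) (hSP : SP G) {v : V}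
    (hv : ∀ g ∈ G, g v = v → g = 1) {x : V} (hx : x ∈ cone G v) {g : V ≃ₗ[ℝ] V} (hg : g ∈ G)
    (hgx : g x ∈ cone G v) : g x = x := by
  obtain ⟨w, hw⟩ := hSP v x
  have norm_orbit : ∀ u : V, ∀ y ∈ MulAction.orbit G u, ‖y‖ = ‖u‖ := by
    intro u y hy
    obtain ⟨k, hk, rfl⟩ := mem_orbit_iff_exists.1 hy
    exact hG.norm_apply hk u
  have norm_hull : ∀ u : V, ∀ y ∈ convexHull ℝ (MulAction.orbit G u), ‖y‖ ≤ ‖u‖ := by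
    intro u y hy
    have : convexHull ℝ (MulAction.orbit G u) ⊆ Metric.closedBall 0 ‖u‖ :=
      convexHull_min (fun z hz => by simp [norm_orbit u z hz]) (convex_closedBall _ _)
    simpa using this hy
  have inner_le : ∀ a ∈ convexHull ℝ (MulAction.orbit G v),
      ∀ b ∈ convexHull ℝ (MulAction.orbit G x), ⟪a, b⟫ ≤ ⟪v, x⟫ := by
    intro a ha b hb
    refine inner_le_of_mem_convexHull (fun y hy => ?_) hb
    rw [real_inner_comm]
    refine inner_le_of_mem_convexHull (fun z hz => ?_) ha
    obtain ⟨k, hk, rfl⟩ := mem_orbit_iff_exists.1 hy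
    obtain ⟨l, hl, rfl⟩ := mem_orbit_iff_exists.1 hz
    rw [← hG.inner_inv_right hk, real_inner_comm x v]
    simpa using mem_cone_iff.1 hx (k⁻¹ * l) (mul_mem (inv_mem hk) hl)
  have hgx_inner : ⟪v, g x⟫ = ⟪v, x⟫ := by
    refine le_antisymm (hG.mem_cone_iff_inner_left.1 hx g hg) ?_
    simpa [inv_apply_apply] using hG.mem_cone_iff_inner_left.1 hgx g⁻¹ (inv_mem hg)
  -- Such a `v + k x` maximizes the norm on the sum of hulls: each term of `‖a‖² + 2⟪a, b⟫ + ‖b‖²`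
  -- is at its maximum. So it is at least as long as `w`.
  have mem_orbit : ∀ k ∈ G, ⟪v, k x⟫ = ⟪v, x⟫ → v + k x ∈ MulAction.orbit G w := by
    intro k hk hkx
    refine mem_of_mem_convexHull_of_norm_le (norm_orbit w) ?_ ?_
    · rw [← hw]
      exact Set.add_mem_add (subset_convexHull ℝ _ (MulAction.mem_orbit_self v))
        (subset_convexHull ℝ _ (apply_mem_orbit hk x))
    · have : w ∈ convexHull ℝ (MulAction.orbit G v) + convexHull ℝ (MulAction.orbit G x) := by
        rw [hw]; exact subset_convexHull ℝ _ (MulAction.mem_orbit_self w)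
      obtain ⟨a, ha, b, hb, hab⟩ := Set.mem_add.1 this
      rw [← hab]
      refine (pow_le_pow_iff_left₀ (norm_nonneg _) (norm_nonneg _) two_ne_zero).1 ?_
      rw [norm_add_sq_real, norm_add_sq_real, hkx, hG.norm_apply hk]
      gcongr
      · exact norm_hull v a ha
      · exact inner_le a ha b hb
      · exact norm_hull x b hb
  have h1 := mem_orbit 1 (one_mem G) rfl
  have h2 := mem_orbit g hg hgx_inner
  rw [← MulAction.orbit_eq_iff] at h1
  rw [← h1] at h2
  obtain ⟨k, hk, hkx⟩ := mem_orbit_iff_exists.1 h2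
  simp only [LinearEquiv.coe_one, id_eq, map_add] at hkx
  -- Pair `k (v + x) = v + g x` with `v`. As `⟪v, k x⟫ ≤ ⟪v, x⟫`, this forces `⟪v, k v⟫ ≥ ⟪v, v⟫`,
  -- hence `k v = v`.
  have h3 : ⟪v, k v⟫ + ⟪v, k x⟫ = ⟪v, v⟫ + ⟪v, x⟫ := by
    rw [← inner_add_right, hkx, inner_add_right, hgx_inner]
  have h4 := hG.mem_cone_iff_inner_left.1 hx k hk
  have h5 : k v = v :=
    eq_of_inner_le_inner_of_norm_eq (hG.norm_apply hk v) (by linarith)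
  rw [hv k hk h5] at hkx
  simpa using hkx.symm

/-! ### Generation by reflections from unique maxima -/

theorem PreservesInner.isHyperplaneReflection_of_sup_eq_top (hG : PreservesInner G)
    {g : V ≃ₗ[ℝ] V} (hg : g ∈ G) {v : V} (hv : g v ≠ v) (h : fixedSpace g ⊔ ℝ ∙ v = ⊤) :
    IsHyperplaneReflection g := by
  have ha : v - g v ≠ 0 := sub_ne_zero.2 hv.symm
  refine ⟨v - g v, ha, fun x => ?_⟩
  obtain ⟨f, hf, y, hy, rfl⟩ := Submodule.mem_sup.1 (h ▸ Submodule.mem_top : x ∈ fixedSpace g ⊔ ℝ ∙ v)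
  obtain ⟨c, rfl⟩ := Submodule.mem_span_singleton.1 hy
  rw [mem_fixedSpace] at hf
  have hfa : ⟪v - g v, f⟫ = 0 := by
    rw [inner_sub_left, sub_eq_zero]
    conv_rhs => rw [← hf]
    exact (hG g hg v f).symm
  have hmem : f ∈ (ℝ ∙ (v - g v))ᗮ := Submodule.mem_orthogonal_singleton_iff_inner_right.2 hfa
  rw [map_add, map_add, map_smul, map_smul, Submodule.reflection_sub (hG.norm_apply hg v).symm,
    Submodule.reflection_mem_subspace_eq_self hmem, hf]

theorem PreservesInner.closure_reflections_eq [FiniteDimensional ℝ V] [Finite G]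
    (hG : PreservesInner G) {v : V} (hv : ∀ g ∈ G, g v = v → g = 1)
    (h : ∀ x ∈ cone G v, ∀ g ∈ G, g x ∈ cone G v → g x = x) :
    Subgroup.closure {g : V ≃ₗ[ℝ] V | g ∈ G ∧ IsHyperplaneReflection g} = G := by
  set N := Subgroup.closure {g : V ≃ₗ[ℝ] V | g ∈ G ∧ IsHyperplaneReflection g}
  have hNG : N ≤ G := (Subgroup.closure_le G).2 fun g hg => hg.1
  refine le_antisymm hNG fun g hg => ?_
  by_contra hgN
  -- Take `p` near `g v`, so that `p` lies in the cone of `g v`, and off the subspaces spanned by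
  -- `v` and the vectors fixed by some `k ∉ N`.
  obtain ⟨p, hp, hpF⟩ : ∃ p, (∀ k ∈ G, k v ≠ g v → ⟪p, k v⟫ < ⟪p, g v⟫) ∧
      ∀ k ∈ G, k ∉ N → p ∉ fixedSpace k ⊔ ℝ ∙ v := by
    have hd := dense_iInter_compl_submodule
      (fun k : {k : G // (k : V ≃ₗ[ℝ] V) ∉ N} => fixedSpace (k.1 : V ≃ₗ[ℝ] V) ⊔ ℝ ∙ v) ?_
    · have hopen : IsOpen (⋂ k : {k : G // (k : V ≃ₗ[ℝ] V) v ≠ g v},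
          {p : V | ⟪p, (k.1 : V ≃ₗ[ℝ] V) v⟫ < ⟪p, g v⟫}) :=
        isOpen_iInter_of_finite fun k => isOpen_lt (by fun_prop) (by fun_prop)
      have hgv : g v ∈ ⋂ k : {k : G // (k : V ≃ₗ[ℝ] V) v ≠ g v},
          {p : V | ⟪p, (k.1 : V ≃ₗ[ℝ] V) v⟫ < ⟪p, g v⟫} := by
        refine Set.mem_iInter.2 fun k => ?_
        by_contra hle
        refine k.2 (eq_of_inner_le_inner_of_norm_eq ?_ (not_lt.1 hle))
        rw [hG.norm_apply k.1.2, hG.norm_apply hg]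
      obtain ⟨p, hp1, hp2⟩ := hd.inter_open_nonempty _ hopen ⟨g v, hgv⟩
      rw [Set.mem_iInter] at hp1 hp2
      exact ⟨p, fun k hk hkv => hp1 ⟨⟨k, hk⟩, hkv⟩, fun k hk hkN => hp2 ⟨⟨k, hk⟩, hkN⟩⟩
    -- These subspaces are proper: otherwise `k` would fix a hyperplane and be a reflection, hence
    -- in `N`.
    · rintro ⟨k, hkN⟩ htop
      have hk1 : (k : V ≃ₗ[ℝ] V) v ≠ v := fun h' => hkN (by rw [hv _ k.2 h']; exact one_mem N)
      exact hkN (Subgroup.subset_closure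
        ⟨k.2, hG.isHyperplaneReflection_of_sup_eq_top k.2 hk1 htop⟩)
  let A : Set V := ⋃ k : {k : G // (k : V ≃ₗ[ℝ] V) ∈ N}, cone G ((k.1 : V ≃ₗ[ℝ] V) v)
  let B : Set V := ⋃ k : {k : G // (k : V ≃ₗ[ℝ] V) ∉ N}, cone G ((k.1 : V ≃ₗ[ℝ] V) v)
  have hA : IsClosed A := isClosed_iUnion_of_finite fun k => isClosed_cone _
  have hB : IsClosed B := isClosed_iUnion_of_finite fun k => isClosed_cone _
  have hcover : segment ℝ v p ⊆ A ∪ B := by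
    intro x _
    obtain ⟨k, hk, hkx⟩ := hG.exists_apply_mem_cone v x
    have hx : x ∈ cone G (k⁻¹ v) := by
      rw [hG.mem_cone_apply (inv_mem hk), inv_inv]; exact hkx
    by_cases hkN : k⁻¹ ∈ N
    · exact Or.inl (Set.mem_iUnion.2 ⟨⟨⟨k⁻¹, inv_mem hk⟩, hkN⟩, hx⟩)
    · exact Or.inr (Set.mem_iUnion.2 ⟨⟨⟨k⁻¹, inv_mem hk⟩, hkN⟩, hx⟩)
  have hvA : v ∈ A := by
    refine Set.mem_iUnion.2 ⟨⟨1, one_mem N⟩, mem_cone_iff.2 fun k hk => ?_⟩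
    have := real_inner_le_norm v (k v)
    rw [hG.norm_apply hk, ← real_inner_self_eq_norm_mul_norm] at this
    simpa using this
  have hpB : p ∈ B := by
    refine Set.mem_iUnion.2 ⟨⟨⟨g, hg⟩, hgN⟩, mem_cone_iff.2 fun k hk => ?_⟩
    by_cases hkv : (k * g) v = g v
    · exact le_of_eq (congrArg (fun y => ⟪p, y⟫) hkv)
    · exact (hp (k * g) (mul_mem hk hg) hkv).le
  -- A segment is connected, so some `x` on it lies in cones of both kinds. Uniqueness of maxima
  -- then yields an element outside `N` fixing `x`.
  obtain ⟨x, hxs, hxA, hxB⟩ := isPreconnected_closed_iff.1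
    (convex_segment (𝕜 := ℝ) v p).isPreconnected A B hA hB hcover
    ⟨v, left_mem_segment ℝ v p, hvA⟩ ⟨p, right_mem_segment ℝ v p, hpB⟩
  obtain ⟨⟨⟨k, hk⟩, hkN⟩, hxk⟩ := Set.mem_iUnion.1 hxA
  obtain ⟨⟨⟨l, hl⟩, hlN⟩, hxl⟩ := Set.mem_iUnion.1 hxB
  simp only at hkN hlN hxk hxl
  rw [hG.mem_cone_apply hk] at hxk
  rw [hG.mem_cone_apply hl] at hxl
  have hx := h _ hxl (k⁻¹ * l) (mul_mem (inv_mem hk) hl) (by simpa [apply_inv_apply] using hxk)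
  have hfix : (k * l⁻¹) x = x := by
    have h' : k⁻¹ x = l⁻¹ x := by simpa [apply_inv_apply] using hx
    rw [LinearEquiv.mul_apply, ← h', apply_inv_apply]
  have hklG : k * l⁻¹ ∈ G := mul_mem hk (inv_mem hl)
  have hklN : k * l⁻¹ ∉ N := fun h' => hlN (by
    have := mul_mem (inv_mem h') hkN
    simpa using this)
  -- If `t = 0`, then `x = v` has trivial stabilizer; otherwise `p` is a combination of `x` and `v`,
  -- which its choice excludes.
  obtain ⟨s, t, hs, ht, hst, rfl⟩ := hxs
  rcases ht.eq_or_lt with rfl | ht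
  · obtain rfl : s = 1 := by linarith
    simp only [one_smul, zero_smul, add_zero] at hfix
    exact hklN (hv _ hklG hfix ▸ one_mem N)
  · refine hpF _ hklG hklN ?_
    have : p = t⁻¹ • (s • v + t • p) + (-(t⁻¹ * s)) • v := by
      rw [smul_add, smul_smul, smul_smul, inv_mul_cancel₀ ht.ne', neg_smul, one_smul]
      abel
    rw [this]
    exact Submodule.add_mem_sup (Submodule.smul_mem _ _ (mem_fixedSpace.2 hfix))
      (Submodule.smul_mem _ _ (Submodule.mem_span_singleton_self v))

/-! ### Roots and chambers -/

/-- The orthogonal reflection in the hyperplane orthogonal to `a`, as a linear automorphism. -/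
noncomputable def mirror (a : V) : V ≃ₗ[ℝ] V :=
  ((ℝ ∙ a)ᗮ.reflection).toLinearEquiv

theorem mirror_apply {a : V} (ha : ‖a‖ = 1) (x : V) : mirror a x = x - (2 * ⟪a, x⟫) • a := by
  change (ℝ ∙ a)ᗮ.reflection x = _
  rw [Submodule.reflection_orthogonal_apply, Submodule.reflection_singleton_apply, ha]
  simp only [RCLike.ofReal_one, one_pow, div_one]
  module

theorem mirror_apply_apply (a x : V) : mirror a (mirror a x) = x :=
  Submodule.reflection_reflection _ x

theorem mirror_mul_self (a : V) : mirror a * mirror a = 1 :=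
  LinearEquiv.ext (mirror_apply_apply a)

theorem mirror_inv (a : V) : (mirror a)⁻¹ = mirror a :=
  inv_eq_of_mul_eq_one_left (mirror_mul_self a)

theorem inner_mirror_mirror (a x y : V) : ⟪mirror a x, mirror a y⟫ = ⟪x, y⟫ :=
  ((ℝ ∙ a)ᗮ.reflection).inner_map_map x y

theorem inner_mirror_left (a x y : V) : ⟪mirror a x, y⟫ = ⟪x, mirror a y⟫ := by
  rw [← inner_mirror_mirror a, mirror_apply_apply]

theorem mirror_self {a : V} (ha : ‖a‖ = 1) : mirror a a = -a := by
  rw [mirror_apply ha, real_inner_self_eq_norm_sq, ha]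
  module

theorem mirror_neg {a : V} (ha : ‖a‖ = 1) : mirror (-a) = mirror a := by
  ext x
  rw [mirror_apply ha, mirror_apply (by rwa [norm_neg]), inner_neg_left]
  module

theorem mirror_eq_conj {g : V ≃ₗ[ℝ] V} (hg : ∀ x y : V, ⟪g x, g y⟫ = ⟪x, y⟫) {a : V}
    (ha : ‖a‖ = 1) : mirror (g a) = g * mirror a * g⁻¹ := by
  have hga : ‖g a‖ = 1 := by
    rw [norm_eq_sqrt_real_inner, hg, ← norm_eq_sqrt_real_inner, ha]
  ext x
  rw [LinearEquiv.mul_apply, LinearEquiv.mul_apply, mirror_apply ha, mirror_apply hga, map_sub,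
    map_smul, apply_inv_apply, ← hg a, apply_inv_apply]

theorem mirror_mirror {a b : V} (hb : ‖b‖ = 1) :
    mirror (mirror a b) = mirror a * mirror b * mirror a := by
  rw [mirror_eq_conj (inner_mirror_mirror a) hb, mirror_inv]

theorem IsHyperplaneReflection.exists_mirror_eq {g : V ≃ₗ[ℝ] V} (hg : IsHyperplaneReflection g) :
    ∃ a : V, ‖a‖ = 1 ∧ mirror a = g := by
  obtain ⟨a, ha, h⟩ := hg
  refine ⟨‖a‖⁻¹ • a, norm_smul_inv_norm ha, ?_⟩
  have : ℝ ∙ (‖a‖⁻¹ • a) = ℝ ∙ a :=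
    Submodule.span_singleton_smul_eq (IsUnit.mk0 _ (inv_ne_zero (norm_ne_zero_iff.2 ha))) a
  ext x
  rw [h x]
  change (ℝ ∙ (‖a‖⁻¹ • a))ᗮ.reflection x = _
  simp only [this]

/-- The vector `v` lies on no mirror of a reflection in `G`. -/
def OffMirrors (G : Subgroup (V ≃ₗ[ℝ] V)) (v : V) : Prop :=
  ∀ a : V, ‖a‖ = 1 → mirror a ∈ G → ⟪v, a⟫ ≠ 0

/-- The unit normals, on the side of `v`, of the mirrors of the reflections in `G`. -/
def posRoots (G : Subgroup (V ≃ₗ[ℝ] V)) (v : V) : Set V :=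
  {a | ‖a‖ = 1 ∧ mirror a ∈ G ∧ 0 < ⟪v, a⟫}

/-- The positive roots whose reflection makes no other positive root negative. -/
def simpleRoots (G : Subgroup (V ≃ₗ[ℝ] V)) (v : V) : Set V :=
  {a | a ∈ posRoots G v ∧ ∀ b ∈ posRoots G v, b ≠ a → mirror a b ∈ posRoots G v}

/-- The closed chamber containing `v`. -/
def closedChamber (G : Subgroup (V ≃ₗ[ℝ] V)) (v : V) : Set V :=
  {x | ∀ a ∈ posRoots G v, 0 ≤ ⟪x, a⟫}

theorem offMirrors_of_forall {v : V} (hv : ∀ g ∈ G, g v = v → g = 1) : OffMirrors G v := by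
  intro a ha hm h0
  have h1 : mirror a v = v := by rw [mirror_apply ha, real_inner_comm, h0]; simp
  have h2 := mirror_self ha
  rw [hv _ hm h1, LinearEquiv.coe_one, id_eq] at h2
  have h3 : ⟪a, a⟫ = -⟪a, a⟫ := by
    rw [← inner_neg_left, ← h2]
  rw [real_inner_self_eq_norm_sq, ha] at h3
  norm_num at h3

theorem OffMirrors.mem_or_neg_mem {v a : V} (hv : OffMirrors G v) (ha : ‖a‖ = 1)
    (hm : mirror a ∈ G) : a ∈ posRoots G v ∨ -a ∈ posRoots G v := by
  rcases (hv a ha hm).lt_or_gt with h | h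
  · exact Or.inr ⟨by rwa [norm_neg], by rwa [mirror_neg ha], by rw [inner_neg_right]; linarith⟩
  · exact Or.inl ⟨ha, hm, h⟩

/-- A positive root is recovered from its reflection by normalizing `v - mirror a v = 2⟪a, v⟫ a`. -/
theorem finite_posRoots [Finite G] (v : V) : (posRoots G v).Finite := by
  refine (Set.finite_range fun g : G =>
    ‖v - (g : V ≃ₗ[ℝ] V) v‖⁻¹ • (v - (g : V ≃ₗ[ℝ] V) v)).subset ?_
  rintro a ⟨ha, hm, hpos⟩
  refine ⟨⟨mirror a, hm⟩, ?_⟩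
  rw [real_inner_comm] at hpos
  have h2 : 0 < 2 * ⟪a, v⟫ := by linarith
  simp only [mirror_apply ha, sub_sub_cancel, norm_smul, ha, mul_one, Real.norm_of_nonneg h2.le,
    smul_smul, inv_mul_cancel₀ h2.ne', one_smul]

theorem PreservesInner.apply_root (hG : PreservesInner G) {g : V ≃ₗ[ℝ] V} (hg : g ∈ G) {a : V}
    (ha : ‖a‖ = 1) (hm : mirror a ∈ G) : ‖g a‖ = 1 ∧ mirror (g a) ∈ G := by
  refine ⟨(hG.norm_apply hg a).trans ha, ?_⟩
  rw [mirror_eq_conj (hG g hg) ha]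
  exact mul_mem (mul_mem hg hm) (inv_mem hg)

/-! ### Simple roots -/

theorem posRoots_eq_of_smul_eq {v a b : V} (ha : a ∈ posRoots G v) (hb : b ∈ posRoots G v)
    (h : ⟪v, a⟫⁻¹ • a = ⟪v, b⟫⁻¹ • b) : a = b := by
  obtain ⟨ha1, -, ha⟩ := ha
  obtain ⟨hb1, -, hb⟩ := hb
  have hn := congrArg norm h
  rw [norm_smul, norm_smul, ha1, hb1, mul_one, mul_one, Real.norm_of_nonneg (inv_pos.2 ha).le,
    Real.norm_of_nonneg (inv_pos.2 hb).le] at hn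
  rw [hn] at h
  exact smul_right_injective V (inv_pos.2 hb).ne' h

/-- Scale positive roots to the slice `⟪v, ·⟫ = 1`. If `mirror b` made a positive `c ≠ b` negative,
then `c` and `d = -mirror b c` would sum to a positive multiple of `b`, so the scaled `b` would lie
between the scaled `c` and `d`. -/
theorem mem_simpleRoots_of_mem_extremePoints (hG : PreservesInner G) {v b : V}
    (hv : OffMirrors G v) (hb : b ∈ posRoots G v)
    (he : ⟪v, b⟫⁻¹ • b ∈
      (convexHull ℝ ((fun a => ⟪v, a⟫⁻¹ • a) '' posRoots G v)).extremePoints ℝ) :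
    b ∈ simpleRoots G v := by
  refine ⟨hb, fun c hc hcb => ?_⟩
  obtain ⟨h1, h2⟩ := hG.apply_root hb.2.1 hc.1 hc.2.1
  rcases hv.mem_or_neg_mem h1 h2 with h | hd
  · exact h
  refine absurd ?_ hcb
  set d := -mirror b c with hd_def
  have hcd : c + d = (2 * ⟪b, c⟫) • b := by
    rw [hd_def, mirror_apply hb.1]; abel
  have hsum : ⟪v, c⟫ + ⟪v, d⟫ = 2 * ⟪b, c⟫ * ⟪v, b⟫ := by
    rw [← inner_add_right, hcd, inner_smul_right]
  have hcpos := hc.2.2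
  have hdpos := hd.2.2
  have hbpos := hb.2.2
  have hspos : 0 < ⟪v, c⟫ + ⟪v, d⟫ := by linarith
  have hmem : ∀ a ∈ posRoots G v,
      ⟪v, a⟫⁻¹ • a ∈ convexHull ℝ ((fun a => ⟪v, a⟫⁻¹ • a) '' posRoots G v) := fun a ha =>
    subset_convexHull ℝ _ ⟨a, ha, rfl⟩
  refine posRoots_eq_of_smul_eq hc hb (he.2 (hmem c hc) (hmem d hd)
    ⟨⟪v, c⟫ / (⟪v, c⟫ + ⟪v, d⟫), ⟪v, d⟫ / (⟪v, c⟫ + ⟪v, d⟫), by positivity, by positivity,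
      by field_simp, ?_⟩)
  rw [smul_smul, smul_smul, div_mul_eq_mul_div, div_mul_eq_mul_div, mul_inv_cancel₀ hcpos.ne',
    mul_inv_cancel₀ hdpos.ne', ← smul_add, hcd, smul_smul]
  congr 1
  rw [hsum] at hspos ⊢
  have : ⟪b, c⟫ ≠ 0 := by rintro h0; simp [h0] at hspos
  field_simp

/-- By Krein–Milman the slice is spanned by scaled simple roots; were `⟪b, ·⟫ ≤ 0` on all of them,
then `⟪b, b⟫ ≤ 0`. -/
theorem exists_simpleRoot_inner_pos [Finite G] (hG : PreservesInner G) {v b : V}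
    (hv : OffMirrors G v) (hb : b ∈ posRoots G v) : ∃ a ∈ simpleRoots G v, 0 < ⟪b, a⟫ := by
  by_contra! hcon
  set P := convexHull ℝ ((fun a => ⟪v, a⟫⁻¹ • a) '' posRoots G v) with hP
  have hcomp : IsCompact P := ((finite_posRoots v).image _).isCompact_convexHull ℝ
  have hKM := closure_convexHull_extremePoints hcomp (convex_convexHull ℝ _)
  have hbP : ⟪v, b⟫⁻¹ • b ∈ P := subset_convexHull ℝ _ ⟨b, hb, rfl⟩
  rw [← hKM] at hbP
  have hsub : closure (convexHull ℝ (P.extremePoints ℝ)) ⊆ {x | ⟪b, x⟫ ≤ 0} := by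
    refine closure_minimal (fun x hx => inner_le_of_mem_convexHull (fun y hy => ?_) hx)
      (isClosed_le (by fun_prop) continuous_const)
    obtain ⟨a, ha, rfl⟩ := extremePoints_convexHull_subset hy
    have hpos := ha.2.2
    rw [inner_smul_right]
    exact mul_nonpos_of_nonneg_of_nonpos (inv_pos.2 hpos).le
      (hcon a (mem_simpleRoots_of_mem_extremePoints hG hv ha hy))
  have := hsub hbP
  have hpos := hb.2.2
  rw [Set.mem_ofPred_eq, inner_smul_right, real_inner_self_eq_norm_sq, hb.1] at this
  have := inv_pos.2 hpos
  linarith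

/-- Descent on the height `⟪v, c⟫`: a simple `a` with `⟪c, a⟫ > 0` reflects `c` to a lower positive
root. -/
theorem mirror_mem_closure_simpleRoots [Finite G] (hG : PreservesInner G) {v : V}
    (hv : OffMirrors G v) {b : V} (hb : b ∈ posRoots G v) :
    mirror b ∈ Subgroup.closure (mirror '' simpleRoots G v) := by
  by_contra hbad
  obtain ⟨c, ⟨hc, hcbad⟩, hmin⟩ := Set.exists_min_image
    {c | c ∈ posRoots G v ∧ mirror c ∉ Subgroup.closure (mirror '' simpleRoots G v)}
    (fun c => ⟪v, c⟫) ((finite_posRoots v).subset fun c hc => hc.1) ⟨b, hb, hbad⟩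
  obtain ⟨a, ha, hca⟩ := exists_simpleRoot_inner_pos hG hv hc
  have hma : mirror a ∈ Subgroup.closure (mirror '' simpleRoots G v) :=
    Subgroup.subset_closure ⟨a, ha, rfl⟩
  have hne : c ≠ a := by rintro rfl; exact hcbad hma
  have hd := ha.2 c hc hne
  by_cases hdbad : mirror (mirror a c) ∈ Subgroup.closure (mirror '' simpleRoots G v)
  · refine hcbad ?_
    rw [← mirror_apply_apply a c, mirror_mirror hd.1]
    exact mul_mem (mul_mem hma hdbad) hma
  · have := hmin _ ⟨hd, hdbad⟩
    simp only [mirror_apply ha.1.1, inner_sub_right, inner_smul_right] at this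
    rw [real_inner_comm] at hca
    nlinarith [mul_pos hca ha.1.2.2]

/-! ### The exchange argument -/

/-- Exchange condition: if the mirror of `t` separates `v` from its image under the word, then
reflecting in `t` cancels a letter. Either `t` is the first letter, or that letter carries `t` to a
positive root to which induction applies. -/
theorem exists_shorter_word {v : V} : ∀ (L : List V), (∀ a ∈ L, a ∈ simpleRoots G v) →
    ∀ t ∈ posRoots G v, ⟪(L.map mirror).prod v, t⟫ < 0 →
      ∃ L' : List V, (∀ a ∈ L', a ∈ simpleRoots G v) ∧ L'.length < L.length ∧
        mirror t * (L.map mirror).prod = (L'.map mirror).prod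
  | [], _, t, ht, hneg => by
    have := ht.2.2
    simp only [List.map_nil, List.prod_nil, LinearEquiv.coe_one, id_eq] at hneg
    linarith
  | a :: L, hL, t, ht, hneg => by
    have ha := hL a List.mem_cons_self
    have hL1 : ∀ b ∈ L, b ∈ simpleRoots G v := fun b hb => hL b (List.mem_cons_of_mem _ hb)
    rw [List.map_cons, List.prod_cons] at hneg ⊢
    by_cases hta : t = a
    · subst hta
      exact ⟨L, hL1, by simp, by rw [← mul_assoc, mirror_mul_self, one_mul]⟩
    · rw [LinearEquiv.mul_apply, inner_mirror_left] at hneg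
      obtain ⟨L', hL', hlen, heq⟩ := exists_shorter_word L hL1 _ (ha.2 t ht hta) hneg
      refine ⟨a :: L', List.forall_mem_cons.2 ⟨ha, hL'⟩, by simpa using hlen, ?_⟩
      rw [List.map_cons, List.prod_cons, ← heq, mirror_mirror ht.1]
      simp only [← mul_assoc, mirror_mul_self, one_mul]

theorem word_mem {v : V} {L : List V} (hL : ∀ a ∈ L, a ∈ simpleRoots G v) :
    (L.map mirror).prod ∈ G := by
  refine Subgroup.list_prod_mem G fun g hg => ?_
  obtain ⟨a, ha, rfl⟩ := List.mem_map.1 hg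
  exact (hL a ha).1.2.1

theorem word_apply_eq_of_mem_closedChamber (hG : PreservesInner G) {v : V} (hv : OffMirrors G v)
    {x : V} (hx : x ∈ closedChamber G v) (L : List V) (hL : ∀ a ∈ L, a ∈ simpleRoots G v)
    (hLx : (L.map mirror).prod x ∈ closedChamber G v) : (L.map mirror).prod x = x := by
  match L with
  | [] => rfl
  | a :: L =>
    have ha := (List.forall_mem_cons.1 hL).1
    have hL1 := (List.forall_mem_cons.1 hL).2
    have hw := word_mem hL
    have hw1 := word_mem hL1
    -- If `a` separates `v` from `w v`, then `w x` lies on the mirror of `a` and the first letter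
    -- can be dropped; otherwise `a` separates `v` from its image under the tail, and exchange
    -- shortens the word.
    by_cases hneg : ⟪((a :: L).map mirror).prod v, a⟫ < 0
    · set w := ((a :: L).map mirror).prod with hw_def
      obtain ⟨h1, h2⟩ := hG.apply_root (inv_mem hw) ha.1.1 ha.1.2.1
      rw [← hG.inner_inv_right hw] at hneg
      have h3 : -(w⁻¹ a) ∈ posRoots G v :=
        (hv.mem_or_neg_mem h1 h2).resolve_left fun h => lt_asymm h.2.2 hneg
      have h4 := hx _ h3
      rw [inner_neg_right, hG.inner_inv_right hw] at h4
      have h5 : ⟪a, w x⟫ = 0 := by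
        rw [real_inner_comm]
        exact le_antisymm (by linarith) (hLx a ha.1)
      have h6 : (L.map mirror).prod x = w x := by
        have : mirror a (w x) = w x := by rw [mirror_apply ha.1.1, h5]; simp
        rw [← this, hw_def, List.map_cons, List.prod_cons, LinearEquiv.mul_apply,
          mirror_apply_apply]
      rw [← h6] at hLx ⊢
      exact word_apply_eq_of_mem_closedChamber hG hv hx L hL1 hLx
    · have hprod : ((a :: L).map mirror).prod = mirror a * (L.map mirror).prod := by simp
      obtain ⟨h1, h2⟩ := hG.apply_root (inv_mem hw1) ha.1.1 ha.1.2.1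
      have h3 := hv _ h1 h2
      rw [hG.inner_inv_right hw1] at h3
      rw [hprod, LinearEquiv.mul_apply, inner_mirror_left, mirror_self ha.1.1, inner_neg_right,
        not_lt] at hneg
      obtain ⟨L', hL', hlen, heq⟩ := exists_shorter_word L hL1 a ha.1
        (lt_of_le_of_ne (by linarith) h3)
      rw [hprod, heq] at hLx ⊢
      exact word_apply_eq_of_mem_closedChamber hG hv hx L' hL' hLx
termination_by L.length
decreasing_by all_goals grind

theorem IsCoxeter.exists_word (hG : PreservesInner G) (hC : IsCoxeter G) {v : V}
    (hv : OffMirrors G v) {g : V ≃ₗ[ℝ] V} (hg : g ∈ G) :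
    ∃ L : List V, (∀ a ∈ L, a ∈ simpleRoots G v) ∧ (L.map mirror).prod = g := by
  obtain ⟨hfin, hcl⟩ := hC
  have hg' : g ∈ Subgroup.closure (mirror '' simpleRoots G v) := by
    have hle : G ≤ Subgroup.closure (mirror '' simpleRoots G v) := by
      rw [← hcl]
      refine (Subgroup.closure_le _).2 ?_
      rintro k ⟨hk, hkr⟩
      obtain ⟨a, ha, rfl⟩ := hkr.exists_mirror_eq
      rw [hcl]
      rcases hv.mem_or_neg_mem ha hk with h | h
      · exact mirror_mem_closure_simpleRoots hG hv h
      · rw [← mirror_neg ha]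
        exact mirror_mem_closure_simpleRoots hG hv h
    exact hle hg
  induction hg' using Subgroup.closure_induction_left with
  | one => exact ⟨[], by simp, rfl⟩
  | mul_left k hk l hl ih =>
    obtain ⟨a, ha, rfl⟩ := hk
    obtain ⟨L, hL, rfl⟩ := ih ((mul_mem_cancel_left ha.1.2.1).1 hg)
    exact ⟨a :: L, List.forall_mem_cons.2 ⟨ha, hL⟩, by simp⟩
  | inv_mul_cancel k hk l hl ih =>
    obtain ⟨a, ha, rfl⟩ := hk
    rw [mirror_inv] at hg ⊢
    obtain ⟨L, hL, rfl⟩ := ih ((mul_mem_cancel_left ha.1.2.1).1 hg)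
    exact ⟨a :: L, List.forall_mem_cons.2 ⟨ha, hL⟩, by simp⟩

theorem IsCoxeter.apply_eq_of_mem_closedChamber (hG : PreservesInner G) (hC : IsCoxeter G) {v : V}
    (hv : OffMirrors G v) {x : V} (hx : x ∈ closedChamber G v) {g : V ≃ₗ[ℝ] V} (hg : g ∈ G)
    (hgx : g x ∈ closedChamber G v) : g x = x := by
  obtain ⟨L, hL, rfl⟩ := hC.exists_word hG hv hg
  exact word_apply_eq_of_mem_closedChamber hG hv hx L hL hgx

/-! ### Cones as chambers, and the semigroup property -/

theorem cone_subset_closedChamber (v : V) : cone G v ⊆ closedChamber G v := by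
  rintro x hx a ⟨ha, hm, hpos⟩
  have := hx _ hm
  rw [mirror_apply ha, sub_sub_cancel, inner_smul_right, real_inner_comm] at this
  exact nonneg_of_mul_nonneg_right this (by linarith)

/-- Each chamber point has a translate in the cone, hence in the chamber, and this translate must be
the point itself. -/
theorem IsCoxeter.cone_eq_closedChamber (hG : PreservesInner G) (hC : IsCoxeter G) {v : V}
    (hv : OffMirrors G v) : cone G v = closedChamber G v := by
  refine (cone_subset_closedChamber v).antisymm fun x hx => ?_
  have := hC.1
  obtain ⟨g, hg, hgx⟩ := hG.exists_apply_mem_cone v x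
  rwa [hC.apply_eq_of_mem_closedChamber hG hv hx hg (cone_subset_closedChamber v hgx)] at hgx

theorem OffMirrors.of_forall_inner_pos {u v : V} (hv : OffMirrors G v)
    (h : ∀ a ∈ posRoots G v, 0 < ⟪u, a⟫) : OffMirrors G u ∧ posRoots G u = posRoots G v := by
  constructor
  · intro a ha hm
    rcases hv.mem_or_neg_mem ha hm with h' | h'
    · exact (h a h').ne'
    · have := h _ h'
      rw [inner_neg_right] at this
      exact (neg_pos.1 this).ne
  · refine Set.Subset.antisymm (fun a ha => ?_) fun a ha => ⟨ha.1, ha.2.1, h a ha⟩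
    refine (hv.mem_or_neg_mem ha.1 ha.2.1).resolve_right fun h' => ?_
    have := h _ h'
    rw [inner_neg_right] at this
    exact lt_asymm ha.2.2 (neg_pos.1 this)

theorem IsCoxeter.eventually_cone_eq (hG : PreservesInner G) (hC : IsCoxeter G) {v : V}
    (hv : OffMirrors G v) : ∀ᶠ u in 𝓝 v, cone G u = cone G v := by
  have := hC.1
  have hev : ∀ᶠ u in 𝓝 v, ∀ a ∈ posRoots G v, 0 < ⟪u, a⟫ := by
    refine (Filter.eventually_all_finite (finite_posRoots v)).2 fun a ha => ?_
    exact (isOpen_lt continuous_const (by fun_prop : Continuous fun u : V => ⟪u, a⟫)).mem_nhds ha.2.2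
  filter_upwards [hev] with u hu
  obtain ⟨h1, h2⟩ := hv.of_forall_inner_pos hu
  rw [hC.cone_eq_closedChamber hG h1, hC.cone_eq_closedChamber hG hv, closedChamber, h2]
  rfl

/-- For points on walls, move `x` into the open chamber as `x + ε • z` and let `ε` tend to `0`. -/
theorem IsCoxeter.mem_cone_of_mem_closedChamber (hG : PreservesInner G) (hC : IsCoxeter G) {z : V}
    (hz : OffMirrors G z) {x u : V} (hx : x ∈ closedChamber G z) (hu : u ∈ closedChamber G z) :
    x ∈ cone G u := by
  refine (isClosed_cone u).mem_of_tendsto (b := 𝓝[>] (0 : ℝ)) (f := fun ε => x + ε • z) ?_ ?_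
  · have : Filter.Tendsto (fun ε : ℝ => x + ε • z) (𝓝 0) (𝓝 (x + (0 : ℝ) • z)) :=
      (by fun_prop : Continuous fun ε : ℝ => x + ε • z).tendsto 0
    rw [zero_smul, add_zero] at this
    exact this.mono_left nhdsWithin_le_nhds
  · filter_upwards [self_mem_nhdsWithin] with ε hε
    obtain ⟨h1, h2⟩ := hz.of_forall_inner_pos (u := x + ε • z) fun a ha => by
      rw [inner_add_left, real_inner_smul_left]
      exact add_pos_of_nonneg_of_pos (hx a ha) (mul_pos hε ha.2.2)
    rw [hG.mem_cone_comm, hC.cone_eq_closedChamber hG h1, closedChamber, h2]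
    exact hu

theorem IsCoxeter.sp [FiniteDimensional ℝ V] (hG : PreservesInner G) (hC : IsCoxeter G) :
    SP G := by
  have := hC.1
  obtain ⟨z, hz⟩ := exists_forall_apply_eq_self_imp (G := G)
  replace hz := offMirrors_of_forall hz
  intro u v
  obtain ⟨g, hg, hgu⟩ := hG.exists_apply_mem_cone z u
  obtain ⟨k, hk, hkv⟩ := hG.exists_apply_mem_cone z v
  rw [← MulAction.orbit_eq_iff.2 (apply_mem_orbit hg u),
    ← MulAction.orbit_eq_iff.2 (apply_mem_orbit hk v)]
  generalize g u = u' at *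
  generalize k v = v' at *
  refine ⟨u' + v', ?_⟩
  rw [← convexHull_add]
  refine Set.Subset.antisymm (convexHull_min ?_ (convex_convexHull ℝ _)) (convexHull_mono ?_)
  · rintro _ ⟨a, ha, b, hb, rfl⟩
    obtain ⟨p, hp, rfl⟩ := mem_orbit_iff_exists.1 ha
    obtain ⟨q, hq, rfl⟩ := mem_orbit_iff_exists.1 hb
    by_contra hnot
    have hclosed : IsClosed (convexHull ℝ (MulAction.orbit G (u' + v'))) :=
      ((Set.finite_range _).isCompact_convexHull ℝ).isClosed
    obtain ⟨f, r, hf, hr⟩ := geometric_hahn_banach_closed_point (convex_convexHull ℝ _) hclosed hnot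
    obtain ⟨x, hx⟩ := (InnerProductSpace.toDual ℝ V).surjective f
    have hfx : ∀ y, f y = ⟪x, y⟫ := fun y => by rw [← hx]; rfl
    obtain ⟨l, hl, hlx⟩ := hG.exists_apply_mem_cone z x
    -- With `l x` in the chamber, `l⁻¹` maximizes `⟪x, m w⟫` for every `w` there, so the same `l⁻¹`
    -- serves `u'`, `v'` and `u' + v'`; no functional separates.
    have key : ∀ w ∈ cone G z, ∀ m ∈ G, ⟪x, m w⟫ ≤ ⟪x, l⁻¹ w⟫ := by
      intro w hw m hm
      have := mem_cone_iff.1 (hC.mem_cone_of_mem_closedChamber hG hz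
        (cone_subset_closedChamber z hlx) (cone_subset_closedChamber z hw)) (l * m) (mul_mem hl hm)
      rwa [LinearEquiv.mul_apply, hG l hl, ← hG.inner_inv_right hl] at this
    have h1 := hf _ (subset_convexHull ℝ _ (apply_mem_orbit (inv_mem hl) (u' + v')))
    rw [hfx, map_add, inner_add_right] at h1
    simp only [hfx, inner_add_right] at hr
    linarith [key u' hgu p hp, key v' hkv q hq]
  · intro y hy
    obtain ⟨p, hp, rfl⟩ := mem_orbit_iff_exists.1 hy
    rw [map_add]
    exact Set.add_mem_add (apply_mem_orbit hp u') (apply_mem_orbit hp v')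

/-! ### Unique maxima from locally constant cones -/

theorem PreservesInner.apply_eq_of_eventually_cone_eq (hG : PreservesInner G) {v : V}
    (hev : ∀ᶠ u in 𝓝 v, cone G u = cone G v) {x : V} (hx : x ∈ cone G v) {g : V ≃ₗ[ℝ] V}
    (hg : g ∈ G) (hgx : g x ∈ cone G v) : g x = x := by
  have h1 : ∀ᶠ u in 𝓝 v, ⟪u, g x - x⟫ = 0 := by
    filter_upwards [hev] with u hu
    rw [← hu, hG.mem_cone_iff_inner_left] at hx hgx
    have := hgx g⁻¹ (inv_mem hg)
    rw [inv_apply_apply] at this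
    rw [inner_sub_right]
    linarith [hx g hg]
  -- Moving `v` slightly along `g x - x` turns the vanishing inner product into `ε‖g x - x‖² = 0`
  -- with `ε ≠ 0`.
  have hc : Filter.Tendsto (fun ε : ℝ => v + ε • (g x - x)) (𝓝[≠] 0) (𝓝 v) := by
    have : Filter.Tendsto (fun ε : ℝ => v + ε • (g x - x)) (𝓝 0) (𝓝 (v + (0 : ℝ) • (g x - x))) :=
      (by fun_prop : Continuous fun ε : ℝ => v + ε • (g x - x)).tendsto 0
    rw [zero_smul, add_zero] at this
    exact this.mono_left nhdsWithin_le_nhds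
  obtain ⟨ε, hε, hne⟩ := ((hc.eventually h1).and self_mem_nhdsWithin).exists
  rw [inner_add_left, h1.self_of_nhds, zero_add, real_inner_smul_left] at hε
  exact sub_eq_zero.1 (inner_self_eq_zero.1 ((mul_eq_zero.1 hε).resolve_left hne))

end LinearGroup

theorem theorem2 {V : Type*} [NormedAddCommGroup V] [InnerProductSpace ℝ V]
    [FiniteDimensional ℝ V] (G : Subgroup (V ≃ₗ[ℝ] V)) (hfin : Finite G)
    (horth : ∀ g ∈ G, ∀ x y : V, ⟪g x, g y⟫ = ⟪x, y⟫) :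
    (LinearGroup.SP G ↔
      ∀ v : V, LinearGroup.IsRegular G v →
        ∀ u : V, LinearGroup.HasPeak (fun x : V => ⟪v, x⟫) (MulAction.orbit G u)) ∧
    (LinearGroup.SP G ↔ LinearGroup.IsCoxeter G) ∧
    (LinearGroup.SP G ↔
      ∀ v : V, LinearGroup.IsRegular G v →
        ∀ᶠ u in 𝓝 v, LinearGroup.cone G u = LinearGroup.cone G v) := by
  have hG : LinearGroup.PreservesInner G := horth
  simp only [hG.forall_hasPeak_iff, LinearGroup.isRegular_iff]
  have sp_peak := fun (h : LinearGroup.SP G) (v : V) (hv : ∀ g ∈ G, g v = v → g = 1) x hx g hg hgx =>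
    LinearGroup.SP.apply_eq_of_mem_cone hG h hv (x := x) hx (g := g) hg hgx
  have peak_coxeter : (∀ v : V, (∀ g ∈ G, g v = v → g = 1) → ∀ x ∈ LinearGroup.cone G v,
      ∀ g ∈ G, g x ∈ LinearGroup.cone G v → g x = x) → LinearGroup.IsCoxeter G := by
    intro h
    obtain ⟨v, hv⟩ := LinearGroup.exists_forall_apply_eq_self_imp (G := G)
    exact ⟨hfin, hG.closure_reflections_eq hv (h v hv)⟩
  have coxeter_sp := LinearGroup.IsCoxeter.sp hG
  refine ⟨⟨sp_peak, fun h => coxeter_sp (peak_coxeter h)⟩,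
    ⟨fun h => peak_coxeter (sp_peak h), coxeter_sp⟩,
    ⟨fun h v hv => (peak_coxeter (sp_peak h)).eventually_cone_eq hG
      (LinearGroup.offMirrors_of_forall hv), fun h => coxeter_sp (peak_coxeter ?_)⟩⟩
  exact fun v hv x hx g hg hgx => hG.apply_eq_of_eventually_cone_eq (h v hv) hx hg hgx
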